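/- Let $K$ be a field of characteristic $0$ (for instance $\mathbb R$ or $\mathbb C$), let $n,r\ge 0$ be integers with $n$ even, and let $V=\{1,\dots,n\}$, $R=\{n+1,\dots,n+r\}$, $V^R=V\cup R$. Let $A^R=(a_{ij})_{i,j\in V^R}$ be a skew-symmetric matrix with entries in $K$ all of whose column sums are zero, and let $A=(a_{ij})_{i,j\in V}$ be obtained from $A^R$ by removing the last $r$ rows and columns. Let $G^R$ be the graph on $V^R$ whose edges are the pairs $ij$ with $a_{ij}\ne 0$, and let $G$ be the graph on $V$ defined in the same way from $A$. An oriented edge $e=(i,j)$ has weight $a_e=a_{ij}$. A *spanning forest* of $G^R$ is a set $F$ of oriented edges of $G^R$ without cycles such that each vertex of $V$ has exactly one outgoing edge in $F$ and vertices of $R$ have none (equivalently: each component is a tree which contains exactly one vertex of $R$ and is oriented towards it). The *trimming algorithm* with input $F$ runs as follows. Put $F_1=F$. In step $i$, as long as $F_i\neq\emptyset$, let $\ell$ be the largest leaf of $F_i$, i.e. the largest vertex that has an outgoing but no incoming edge in $F_i$. Starting from $\ell$, follow the oriented edges of $F_i$ until one first reaches, after at least one edge, a vertex that belongs to $R$,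 or has more than one incoming edge in $F_i$, or is smaller than $\ell$. Let $\lambda_i$ be the path so obtained, and let $F_{i+1}$ be $F_i$ with the edges of $\lambda_i$ removed. The algorithm stops when no edge is left. The forest $F$ satisfies *Condition (C)* if all paths $\lambda_1,\dots,\lambda_N$ so produced have even length (number of edges). Let $\mathcal F$ be the set of spanning forests of $G^R$ satisfying Condition (C). For a perfect matching $M_0$ of $G$, let $\mathcal F(M_0)$ be the set of spanning forests $F$ of $G^R$ that contain all edges of $M_0$ (with some orientation), and for which all paths produced by the trimming algorithm have even length and start with an edge of $M_0$. Then $$\det(A)=\sum_{F\in\mathcal F}\ \prod_{e\in F}a_e .$$ Moreover $\mathcal F=\bigcup_{M_0}\mathcal F(M_0)$, where the union is over all perfect matchings $M_0$ of $G$, and the sets $\mathcal F(M_0)$ are pairwise disjoint. -/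

import Mathlib

namespace TrimmedForest

section General

variable {V : Type*}

/-- The weighted graph of a skew-symmetric matrix `a`: the edges are the pairs `ij` with
`a i j ≠ 0` (for skew-symmetric `a` this condition is symmetric and excludes loops). -/
def graph {K : Type*} [Zero K] (a : Matrix V V K) : SimpleGraph V :=
  SimpleGraph.fromRel fun i j => a i j ≠ 0

/-- A spanning forest with root set `roots` in the graph of `a`. The pair `(v, w) ∈ F` is the edge
`vw` oriented from `v` to `w`. The oriented edge configuration contains no cycle, each vertex
outside `roots` has exactly one outgoing edge, and roots have none. Equivalently, each connected
component is a tree which contains exactly one root and is oriented towards it. -/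
structure IsSpanningForest {K : Type*} [Zero K] (a : Matrix V V K) (roots : Set V)
    (F : Finset (V × V)) : Prop where
  edge_mem : ∀ v w, (v, w) ∈ F → a v w ≠ 0
  existsUnique_out : ∀ v, v ∉ roots → ∃! w, (v, w) ∈ F
  root_no_out : ∀ v, v ∈ roots → ∀ w, (v, w) ∉ F
  acyclic : ∀ v, ¬ Relation.TransGen (fun x y => (x, y) ∈ F) v v

/-- `v` is a leaf of `F`: a vertex of `F` with no incoming edge. (A vertex of an edge configuration
is the end of one of its edges, so a leaf has an outgoing edge.) -/
def IsLeaf (F : Finset (V × V)) (v : V) : Prop :=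
  (∃ w, (v, w) ∈ F) ∧ ∀ u, (u, v) ∉ F

/-- `v` is a fork of `F`: a vertex with more than one incoming edge. -/
def IsFork (F : Finset (V × V)) (v : V) : Prop :=
  ∃ u₁ u₂, u₁ ≠ u₂ ∧ (u₁, v) ∈ F ∧ (u₂, v) ∈ F

/-- The vertices at which the path started at the leaf `l` of the current configuration `F` is
stopped: roots, forks of `F`, and vertices smaller than `l`. -/
def IsStop [LinearOrder V] (roots : Set V) (F : Finset (V × V)) (l v : V) : Prop :=
  v ∈ roots ∨ IsFork F v ∨ v < l

/-- The oriented edges of the path with successive vertices `p`; the number of entries of this list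
is the length of the path. -/
def pathEdges (p : List V) : List (V × V) :=
  p.zip p.tail

/-- `p` lists the vertices of the path that one step of the trimming algorithm produces from `F`:
it starts at the largest leaf `l` of `F` and follows the edges of `F` up to the first vertex `w`
after `l` which is a root, a fork of `F` or smaller than `l`. -/
def IsTrimPath [LinearOrder V] (roots : Set V) (F : Finset (V × V)) (p : List V) : Prop :=
  ∃ (l : V) (q : List V) (w : V), p = l :: (q ++ [w]) ∧
    IsGreatest {v | IsLeaf F v} l ∧
    (∀ e ∈ pathEdges p, e ∈ F) ∧
    (∀ v ∈ q, ¬ IsStop roots F l v) ∧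
    IsStop roots F l w

/-- `TrimRun roots F ps`: the trimming algorithm with input `F` terminates and produces
successively the paths in the list `ps`. -/
inductive TrimRun [LinearOrder V] (roots : Set V) :
    Finset (V × V) → List (List V) → Prop
  | done : TrimRun roots ∅ []
  | step {F : Finset (V × V)} {p : List V} {ps : List (List V)} :
      F.Nonempty → IsTrimPath roots F p →
      TrimRun roots (F \ (pathEdges p).toFinset) ps → TrimRun roots F (p :: ps)

/-- Condition (C), without reference matching: all paths obtained from the trimming algorithm have
even length. (On a spanning forest the algorithm is deterministic and terminates.) -/
def ConditionC [LinearOrder V] (roots : Set V) (F : Finset (V × V)) : Prop :=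
  ∃ ps, TrimRun roots F ps ∧ ∀ p ∈ ps, Even (pathEdges p).length

/-- Condition (C) relative to a set `M` of unoriented edges: all paths obtained from the trimming
algorithm have even length and start from an edge of `M`. -/
def ConditionCRel [LinearOrder V] (roots : Set V) (M : Set (Sym2 V)) (F : Finset (V × V)) :
    Prop :=
  ∃ ps, TrimRun roots F ps ∧ ∀ p ∈ ps, Even (pathEdges p).length ∧
    ∃ e, (pathEdges p).head? = some e ∧ s(e.1, e.2) ∈ M

/-- `F` is compatible with `M`: all edges of `M` are edges of `F`. (A spanning forest has as many
edges as there are vertices outside the root set, so when `M` is a perfect matching of these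
vertices, `F` consists of the edges of `M` and as many other edges.) -/
def IsCompatible (M : Set (Sym2 V)) (F : Finset (V × V)) : Prop :=
  ∀ e ∈ M, ∃ v w, (v, w) ∈ F ∧ s(v, w) = e

end General

section Matrix

variable {K : Type*} [Zero K] {n r : ℕ}

/-- The set `R` of the last `r` of the `n + r` vertices. -/
def rootSet (n r : ℕ) : Set (Fin (n + r)) :=
  Set.range (Fin.natAdd n)

/-- The matrix `A` obtained from `A^R` by removing the last `r` lines and columns. -/
def principal (a : Matrix (Fin (n + r)) (Fin (n + r)) K) : Matrix (Fin n) (Fin n) K :=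
  a.submatrix (Fin.castAdd r) (Fin.castAdd r)

open Classical in
/-- The set of all spanning forests of `G^R` which satisfy Condition (C). -/
noncomputable def forests (a : Matrix (Fin (n + r)) (Fin (n + r)) K) :
    Finset (Finset (Fin (n + r) × Fin (n + r))) :=
  Finset.univ.filter fun F => IsSpanningForest a (rootSet n r) F ∧ ConditionC (rootSet n r) F

/-- The edges of a subgraph `M` of `G`, as unoriented edges between vertices of `G^R`. -/
def matchingEdges {a : Matrix (Fin (n + r)) (Fin (n + r)) K} (M : (graph (principal a)).Subgraph) :
    Set (Sym2 (Fin (n + r))) :=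
  Sym2.map (Fin.castAdd r) '' M.edgeSet

/-- The set of the spanning forests of `G^R` which are compatible with the perfect matching `M` of
`G` and satisfy Condition (C) relative to `M`. -/
def forestsOf (a : Matrix (Fin (n + r)) (Fin (n + r)) K) (M : (graph (principal a)).Subgraph) :
    Set (Finset (Fin (n + r) × Fin (n + r))) :=
  {F | IsSpanningForest a (rootSet n r) F ∧ IsCompatible (matchingEdges M) F ∧
    ConditionCRel (rootSet n r) (matchingEdges M) F}

end Matrix

end TrimmedForest

/-!
The trimming algorithm is best read backwards. Let `U` be the set of the vertices that are not
roots. Starting from the smallest vertex of `U`, follow the edges of the forest `F` until they leave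
`U`; remove the vertices of this branch from `U`, count them as roots, and repeat. The trimming
algorithm produces exactly these branches, in reverse order (`Branching.trimRun`): a trimmed path
that arrives at an earlier branch stops there, either at a fork or at the first vertex of the
branch, which is smaller than the current leaf. Hence Condition (C) says that all branches have even
length (`isForestOn_and_conditionC_iff`).

The formula for the determinant is then proved by drawing the branches step by step. Let `d U` be
the principal minor on `U` and `Q W x s` the determinant with rows `W ∪ {x}` and columns `W ∪ {s}`.
Expansion along the row `x` gives `Q W x s = a x s * d W - ∑ u ∈ W, a x u * Q (W \ {u}) u s`, where
`Q (W \ {u}) u u = d W`. If the first branch has reached `x` and `W` is the set of unvisited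
vertices, the total weight of all completions is `± ∑ s ∈ U \ W, Q W x s`, with a sign depending on
the parity of `W` (`weightSum_completes_eq`). Indeed both sides satisfy the same recursion: the
branch may leave `U` when `W` is even, with weight `-∑ s ∈ U, a x s` because rows sum to zero, and
when `W` is odd then `d W = 0` by skew-symmetry. For `U` even and `x` the first vertex, the sum is
`d U` (`weightSum_evenBranching`).

As for the matchings, the branches of even length, without their ends, partition the vertices that
are not roots, so that every other edge of the branches gives a perfect matching of these vertices,
consisting of edges of `F` (`Branching.isPairing`). Conversely, if `F` contains a perfect matching
and each branch starts with one of its edges, then the branches alternate, and the matching is the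
one just described (`Branching.pathMatching_subset`). So `F` belongs to exactly one matching.
-/

namespace TrimmedForest

/-! ### Determinants bordered by a row and a column -/

section Determinant

variable {α K : Type*} [DecidableEq α] [CommRing K]

/-- Expansion along the row `none`. In the minor of `some u` the column `none` takes the place of
the column `u`, which accounts for the uniform minus sign. -/
theorem det_option {β : Type*} [Fintype β] [DecidableEq β] (M : Matrix (Option β) (Option β) K) :
    M.det = M none none * (Matrix.of fun i j : β => M (some i) (some j)).det -
      ∑ u : β, M none (some u) *
        (Matrix.of fun i j : β => if j = u then M (some i) none else M (some i) (some j)).det := by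
  rw [← Matrix.det_transpose, Matrix.det_apply',
    ← Equiv.sum_comp (Equiv.Perm.decomposeOption (α := β)).symm, Fintype.sum_prod_type,
    Fintype.sum_option]
  rw [sub_eq_add_neg, ← Finset.sum_neg_distrib]
  congr 1
  · rw [← Matrix.det_transpose, Matrix.det_apply', Finset.mul_sum]
    refine Finset.sum_congr rfl fun τ _ => ?_
    simp [Fintype.prod_option, Equiv.Perm.decomposeOption]
    ring
  · refine Finset.sum_congr rfl fun u _ => ?_
    rw [← Matrix.det_transpose, Matrix.det_apply', Finset.mul_sum, ← Finset.sum_neg_distrib]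
    refine Finset.sum_congr rfl fun τ _ => ?_
    have h (i : β) : M (some i) (Equiv.swap none (some u) (some (τ i))) =
        if τ i = u then M (some i) none else M (some i) (some (τ i)) := by
      split_ifs with h
      · rw [h, Equiv.swap_apply_right]
      · rw [Equiv.swap_apply_of_ne_of_ne (by simp) (by simpa using h)]
    simp [Fintype.prod_option, Equiv.Perm.decomposeOption, h]
    ring

/-- The determinant of the square submatrix of `a` with rows and columns in `U`. -/
def subDet (a : Matrix α α K) (U : Finset α) : K :=
  (Matrix.of fun i j : U => a i j).det

/-- The determinant of the submatrix of `a` with rows `U ∪ {x}` and columns `U ∪ {y}`, the row `x`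
and the column `y` being placed at the common index `none`. -/
def borderedDet (a : Matrix α α K) (U : Finset α) (x y : α) : K :=
  (Matrix.of fun i j : Option U => a (i.elim x (↑)) (j.elim y (↑))).det

/-- Adjoining `u` to `U.erase u`, where `u` becomes `none`. -/
noncomputable def optionEraseEquiv (U : Finset α) (u : U) : Option (U.erase u : Finset α) ≃ U :=
  Equiv.ofBijective (fun o => o.elim u fun z => ⟨z, Finset.mem_of_mem_erase z.2⟩) <| by
    constructor
    · rintro (_ | ⟨x, hx⟩) (_ | ⟨y, hy⟩) h
      · rfl
      · exact absurd (congrArg Subtype.val h).symm (Finset.ne_of_mem_erase hy)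
      · exact absurd (congrArg Subtype.val h) (Finset.ne_of_mem_erase hx)
      · simpa using h
    · intro z
      by_cases h : z = u
      · exact ⟨none, h.symm⟩
      · exact ⟨some ⟨z, Finset.mem_erase.2 ⟨fun h' => h (Subtype.ext h'), z.2⟩⟩, rfl⟩

/-- Putting the column `y` in the place of the column `u`. -/
theorem borderedDet_erase_eq_det (a : Matrix α α K) (U : Finset α) (u : U) (y : α) :
    borderedDet a (U.erase u) u y =
      (Matrix.of fun i j : U => if j = u then a i y else a i j).det := by
  rw [← Matrix.det_submatrix_equiv_self (optionEraseEquiv U u), borderedDet]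
  congr 1
  ext i j
  have hi : ((optionEraseEquiv U u i : U) : α) = i.elim (u : α) (↑) := by
    cases i <;> rfl
  cases j with
  | none =>
    have hj : optionEraseEquiv U u none = u := rfl
    simp [hi, hj]
  | some j =>
    have hj : ¬ (optionEraseEquiv U u (some j)) = u := fun h =>
      Finset.ne_of_mem_erase j.2 (congrArg Subtype.val h)
    simp [hi, hj]
    rfl

theorem borderedDet_erase_self (a : Matrix α α K) {U : Finset α} {u : α} (hu : u ∈ U) :
    borderedDet a (U.erase u) u u = subDet a U := by
  have := borderedDet_erase_eq_det a U ⟨u, hu⟩ u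
  rw [this, subDet]
  congr 1
  ext i j
  by_cases h : j = ⟨u, hu⟩ <;> simp [h]

/-- Expansion along the row `x`. Its minors are again bordered determinants, in which a vertex `u`
of `U` has taken the place of `x`: this is the first step `x → u` of a path. -/
theorem borderedDet_eq_sub_sum (a : Matrix α α K) (U : Finset α) (x y : α) :
    borderedDet a U x y =
      a x y * subDet a U - ∑ u ∈ U, a x u * borderedDet a (U.erase u) u y := by
  rw [borderedDet, det_option, ← Finset.sum_coe_sort U]
  congr 1
  refine Finset.sum_congr rfl fun u _ => ?_
  rw [borderedDet_erase_eq_det]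
  rfl

theorem subDet_empty (a : Matrix α α K) : subDet a ∅ = 1 :=
  Matrix.det_isEmpty

theorem subDet_eq_zero_of_odd {K : Type*} [Field K] [CharZero K] {a : Matrix α α K}
    (ha : a.transpose = -a) {U : Finset α} (hU : Odd U.card) : subDet a U = 0 := by
  have h : (Matrix.of fun i j : U => a i j).transpose = -(Matrix.of fun i j : U => a i j) := by
    ext i j
    exact congrFun (congrFun ha i) j
  have h' := congrArg Matrix.det h
  rw [Matrix.det_transpose, Matrix.det_neg, Fintype.card_coe, hU.neg_one_pow] at h'
  exact self_eq_neg.1 (h'.trans (neg_one_mul _))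

end Determinant

/-! ### Edges of paths -/

section Paths

variable {α : Type*}

theorem pathEdges_cons_cons (x y : α) (t : List α) :
    pathEdges (x :: y :: t) = (x, y) :: pathEdges (y :: t) :=
  rfl

theorem length_pathEdges_cons (x : α) (t : List α) : (pathEdges (x :: t)).length = t.length := by
  simp [pathEdges]

theorem fst_mem_of_mem_pathEdges {e : α × α} {x w : α} {q : List α}
    (h : e ∈ pathEdges (x :: (q ++ [w]))) : e.1 ∈ x :: q := by
  induction q generalizing x with
  | nil =>
    obtain rfl : e = (x, w) := by simpa [pathEdges] using h
    simp
  | cons y q ih =>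
    rw [List.cons_append, pathEdges_cons_cons, List.mem_cons] at h
    rcases h with rfl | h
    · simp
    · exact List.mem_cons_of_mem _ (ih h)

theorem snd_mem_of_mem_pathEdges {e : α × α} {x : α} {t : List α}
    (h : e ∈ pathEdges (x :: t)) : e.2 ∈ t :=
  (List.of_mem_zip h).2

theorem exists_mem_pathEdges_left {x v w : α} {q : List α} (h : v ∈ x :: q) :
    ∃ u, (v, u) ∈ pathEdges (x :: (q ++ [w])) := by
  induction q generalizing x with
  | nil => exact ⟨w, by simp_all [pathEdges]⟩
  | cons y q ih =>
    rw [List.cons_append, pathEdges_cons_cons]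
    rcases List.mem_cons.1 h with rfl | h
    · exact ⟨y, List.mem_cons_self⟩
    · obtain ⟨u, hu⟩ := ih h
      exact ⟨u, List.mem_cons_of_mem _ hu⟩

theorem exists_mem_pathEdges_right {x v : α} {t : List α} (h : v ∈ t) :
    ∃ u, (u, v) ∈ pathEdges (x :: t) := by
  induction t generalizing x with
  | nil => simp at h
  | cons y t ih =>
    rw [pathEdges_cons_cons]
    rcases List.mem_cons.1 h with rfl | h
    · exact ⟨x, List.mem_cons_self⟩
    · obtain ⟨u, hu⟩ := ih h
      exact ⟨u, List.mem_cons_of_mem _ hu⟩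

theorem eq_of_mem_pathEdges_right {x u u' v : α} {t : List α} (ht : t.Nodup)
    (h : (u, v) ∈ pathEdges (x :: t)) (h' : (u', v) ∈ pathEdges (x :: t)) : u = u' := by
  induction t generalizing x with
  | nil => simp [pathEdges] at h
  | cons y t ih =>
    rw [List.nodup_cons] at ht
    rw [pathEdges_cons_cons, List.mem_cons, Prod.mk.injEq] at h h'
    rcases h with ⟨rfl, rfl⟩ | h <;> rcases h' with ⟨rfl, hy⟩ | h'
    · rfl
    · exact absurd (snd_mem_of_mem_pathEdges h') ht.1
    · exact absurd (hy ▸ snd_mem_of_mem_pathEdges h) ht.1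
    · exact ih ht.2 h h'

theorem eq_of_mem_pathEdges_left {v u u' : α} {p : List α} (hp : p.Nodup)
    (h : (v, u) ∈ pathEdges p) (h' : (v, u') ∈ pathEdges p) : u = u' := by
  induction p with
  | nil => simp [pathEdges] at h
  | cons x t ih =>
    cases t with
    | nil => simp [pathEdges] at h
    | cons y t =>
      rw [List.nodup_cons] at hp
      rw [pathEdges_cons_cons, List.mem_cons, Prod.mk.injEq] at h h'
      rcases h with ⟨rfl, rfl⟩ | h <;> rcases h' with ⟨hv, rfl⟩ | h'
      · rfl
      · exact absurd (List.of_mem_zip h').1 hp.1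
      · exact absurd (hv ▸ (List.of_mem_zip h).1) hp.1
      · exact ih hp.2 h h'

/-- Along a path without repeated vertices some bounded rank decreases. -/
theorem exists_rank_pathEdges [DecidableEq α] {p : List α} (hp : p.Nodup) :
    ∃ (g : α → ℕ) (b : ℕ), (∀ v, g v < b) ∧ ∀ e ∈ pathEdges p, g e.2 < g e.1 := by
  induction p with
  | nil => exact ⟨fun _ => 0, 1, by simp [pathEdges]⟩
  | cons x t ih =>
    rw [List.nodup_cons] at hp
    obtain ⟨g, b, hb, hg⟩ := ih hp.2
    refine ⟨fun v => if v = x then b else g v, b + 1, fun v => ?_, fun e he => ?_⟩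
    · have := hb v
      dsimp only
      split_ifs <;> omega
    · have h2 : e.2 ≠ x := fun h => hp.1 (h ▸ snd_mem_of_mem_pathEdges he)
      cases t with
      | nil => simp [pathEdges] at he
      | cons y t =>
        rw [pathEdges_cons_cons, List.mem_cons] at he
        rcases he with rfl | he
        · simpa [h2] using hb y
        · have h1 : e.1 ≠ x := fun h => hp.1 (h ▸ (List.of_mem_zip he).1)
          simpa [h1, h2] using hg e he

theorem nodup_append_of_notMem {l w : α} {q : List α} {U : Finset α} (hl : l ∈ U)
    (hn : (l :: q).Nodup) (hq : ∀ v ∈ q, v ∈ U) (hw : w ∉ U) : (l :: (q ++ [w])).Nodup := by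
  rw [← List.cons_append, List.nodup_append]
  refine ⟨hn, List.nodup_singleton w, fun v hv v' hv' h => hw ?_⟩
  rw [List.mem_singleton] at hv'
  rw [← hv', ← h]
  rcases List.mem_cons.1 hv with rfl | hv
  exacts [hl, hq v hv]

end Paths

/-! ### Decomposition of forests into branches -/

section Branches

variable {α : Type*}

/-- A spanning forest with root set the complement of `U`, without regard to weights. -/
structure IsForestOn (U : Finset α) (F : Finset (α × α)) : Prop where
  fst_mem : ∀ e ∈ F, e.1 ∈ U
  existsUnique_out : ∀ v ∈ U, ∃! w, (v, w) ∈ F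
  acyclic : ∀ v, ¬ Relation.TransGen (fun x y => (x, y) ∈ F) v v

theorem IsForestOn.eq_of_mem {U : Finset α} {F : Finset (α × α)} (h : IsForestOn U F)
    {v w w' : α} (hw : (v, w) ∈ F) (hw' : (v, w') ∈ F) : w = w' :=
  (h.existsUnique_out v (h.fst_mem _ hw)).unique hw hw'

variable [LinearOrder α]

/-- `Branching U F ps`: the edge set `F` is decomposed into the branches `ps`. The first branch
starts from the smallest vertex of `U` and runs through distinct vertices of `U` up to a vertex
outside `U`; the other branches decompose the rest of `F` in the same way, the vertices of the first
branch now counting as roots. -/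
inductive Branching : Finset α → Finset (α × α) → List (List α) → Prop
  | nil : Branching ∅ ∅ []
  | cons {U : Finset α} {F : Finset (α × α)} {ps : List (List α)} {l w : α} {q : List α} :
      l ∈ U → (∀ u ∈ U, l ≤ u) → (l :: q).Nodup → (∀ v ∈ q, v ∈ U) → w ∉ U →
      Branching (U \ (l :: q).toFinset) F ps →
      Branching U ((pathEdges (l :: (q ++ [w]))).toFinset ∪ F) ((l :: (q ++ [w])) :: ps)

/-- A rank decreasing along all edges, which excludes cycles: on the later branches it is shifted
above its values on the first one, since later branches may end on the first but not conversely. -/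
theorem Branching.exists_rank {U : Finset α} {F : Finset (α × α)} {ps : List (List α)}
    (h : Branching U F ps) : ∃ g : α → ℕ, ∀ e ∈ F, g e.2 < g e.1 := by
  have key : (∀ e ∈ F, e.1 ∈ U) ∧ ∃ g : α → ℕ, ∀ e ∈ F, g e.2 < g e.1 := by
    induction h with
    | nil => simp
    | @cons U F ps l w q hl hmin hn hq hw hF ih =>
      obtain ⟨hU, g, hg⟩ := ih
      obtain ⟨g', b, hb, hg'⟩ := exists_rank_pathEdges (nodup_append_of_notMem hl hn hq hw)
      have hlq : ∀ v ∈ l :: q, v ∈ U := by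
        intro v hv
        rcases List.mem_cons.1 hv with rfl | hv
        exacts [hl, hq v hv]
      refine ⟨fun e he => ?_,
        fun v => if v ∈ U \ (l :: q).toFinset then g v + b else g' v, fun e he => ?_⟩
      · rw [Finset.mem_union, List.mem_toFinset] at he
        rcases he with he | he
        · exact hlq _ (fst_mem_of_mem_pathEdges he)
        · exact (Finset.mem_sdiff.1 (hU e he)).1
      · rw [Finset.mem_union, List.mem_toFinset] at he
        rcases he with he | he
        · have h1 : e.1 ∉ U \ (l :: q).toFinset := by
            simp only [Finset.mem_sdiff, List.mem_toFinset, not_and, not_not]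
            exact fun _ => fst_mem_of_mem_pathEdges he
          have h2 : e.2 ∉ U \ (l :: q).toFinset := by
            simp only [Finset.mem_sdiff, List.mem_toFinset, not_and, not_not]
            intro h
            rcases List.mem_append.1 (snd_mem_of_mem_pathEdges he) with h' | h'
            · exact List.mem_cons_of_mem _ h'
            · exact absurd (List.mem_singleton.1 h' ▸ h) hw
          simpa only [if_neg h1, if_neg h2] using hg' e he
        · dsimp only
          rw [if_pos (hU e he)]
          have := hg e he
          have := hb e.2
          split_ifs <;> omega
  exact key.2

theorem Branching.isForestOn {U : Finset α} {F : Finset (α × α)} {ps : List (List α)}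
    (h : Branching U F ps) : IsForestOn U F := by
  obtain ⟨g, hg⟩ := h.exists_rank
  have hac : ∀ v, ¬ Relation.TransGen (fun x y => (x, y) ∈ F) v v := by
    have key : ∀ x y, Relation.TransGen (fun x y => (x, y) ∈ F) x y → g y < g x := by
      intro x y hxy
      induction hxy with
      | single h => exact hg _ h
      | tail _ h ih => exact (hg _ h).trans ih
    exact fun v hv => lt_irrefl _ (key v v hv)
  have : (∀ e ∈ F, e.1 ∈ U) ∧ ∀ v ∈ U, ∃! w, (v, w) ∈ F := by
    clear hac hg
    induction h with
    | nil => simp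
    | @cons U F ps l w q hl hmin hn hq hw hF ih =>
      obtain ⟨hU, hF'⟩ := ih
      have hlq : ∀ v ∈ l :: q, v ∈ U := by
        intro v hv
        rcases List.mem_cons.1 hv with rfl | hv
        exacts [hl, hq v hv]
      refine ⟨fun e he => ?_, fun v hv => ?_⟩
      · rw [Finset.mem_union, List.mem_toFinset] at he
        rcases he with he | he
        · exact hlq _ (fst_mem_of_mem_pathEdges he)
        · exact (Finset.mem_sdiff.1 (hU e he)).1
      · by_cases hv' : v ∈ l :: q
        · obtain ⟨u, hu⟩ := exists_mem_pathEdges_left (w := w) hv'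
          refine ⟨u, by simp only [Finset.mem_union, List.mem_toFinset]; exact Or.inl hu,
            fun u' hu' => ?_⟩
          simp only [Finset.mem_union, List.mem_toFinset] at hu'
          rcases hu' with hu' | hu'
          · exact eq_of_mem_pathEdges_left (nodup_append_of_notMem hl hn hq hw) hu' hu
          · exact absurd hv' (by simpa using (Finset.mem_sdiff.1 (hU _ hu')).2)
        · obtain ⟨u, hu, huniq⟩ := hF' v (by simpa [hv] using hv')
          refine ⟨u, Finset.mem_union_right _ hu, fun u' hu' => ?_⟩
          simp only [Finset.mem_union, List.mem_toFinset] at hu'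
          rcases hu' with hu' | hu'
          · exact absurd (fst_mem_of_mem_pathEdges hu') hv'
          · exact huniq u' hu'
  exact ⟨this.1, this.2, hac⟩

/-- Following the edges of a forest one leaves `U`. -/
theorem IsForestOn.exists_path [Finite α] {U : Finset α} {F : Finset (α × α)} (h : IsForestOn U F)
    {x : α} (hx : x ∈ U) :
    ∃ (q : List α) (w : α), (x :: q).Nodup ∧ (∀ v ∈ q, v ∈ U) ∧ w ∉ U ∧
      ∀ e ∈ pathEdges (x :: (q ++ [w])), e ∈ F := by
  let R : α → α → Prop := fun y x => Relation.TransGen (fun x y => (x, y) ∈ F) x y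
  have : Std.Irrefl R := ⟨h.acyclic⟩
  have : IsTrans α R := ⟨fun _ _ _ hab hbc => hbc.trans hab⟩
  have hR : WellFounded R := Finite.wellFounded_of_trans_of_irrefl R
  have key : ∀ x, x ∈ U → ∃ (q : List α) (w : α), (x :: q).Nodup ∧ (∀ v ∈ q, v ∈ U) ∧ w ∉ U ∧
      (∀ e ∈ pathEdges (x :: (q ++ [w])), e ∈ F) ∧ ∀ v ∈ q, R v x := by
    intro x
    induction x using hR.induction with
    | _ x ih =>
      intro hx
      obtain ⟨y, hy, -⟩ := h.existsUnique_out x hx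
      have hyx : R y x := .single hy
      by_cases hyU : y ∈ U
      · obtain ⟨q, w, hn, hq, hw, he, hr⟩ := ih y hyx hyU
        have hr' : ∀ v ∈ y :: q, R v x := by
          intro v hv
          rcases List.mem_cons.1 hv with rfl | hv
          exacts [hyx, hyx.trans (hr v hv)]
        refine ⟨y :: q, w, List.nodup_cons.2 ⟨fun hx' => h.acyclic x (hr' x hx'), hn⟩, ?_, hw, ?_,
          hr'⟩
        · intro v hv
          rcases List.mem_cons.1 hv with rfl | hv
          exacts [hyU, hq v hv]
        · intro e hmem
          rw [List.cons_append, pathEdges_cons_cons, List.mem_cons] at hmem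
          rcases hmem with rfl | hmem
          exacts [hy, he e hmem]
      · refine ⟨[], y, List.nodup_singleton x, by simp, hyU, ?_, by simp⟩
        intro e he
        obtain rfl : e = (x, y) := by simpa [pathEdges] using he
        exact hy
  obtain ⟨q, w, hn, hq, hw, he, -⟩ := key x hx
  exact ⟨q, w, hn, hq, hw, he⟩

theorem IsForestOn.exists_branching [Finite α] {U : Finset α} {F : Finset (α × α)}
    (h : IsForestOn U F) : ∃ ps, Branching U F ps := by
  induction U using Finset.strongInduction generalizing F with
  | H U ih =>
    rcases U.eq_empty_or_nonempty with rfl | hne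
    · have : F = ∅ := Finset.eq_empty_of_forall_notMem fun e he => by simpa using h.fst_mem e he
      exact this ▸ ⟨[], .nil⟩
    · set l := U.min' hne
      have hl : l ∈ U := U.min'_mem hne
      obtain ⟨q, w, hn, hq, hw, he⟩ := h.exists_path hl
      set F' := F.filter fun e => e.1 ∉ l :: q
      have hF' : IsForestOn (U \ (l :: q).toFinset) F' := by
        refine ⟨fun e he' => ?_, fun v hv => ?_, fun v hv => ?_⟩
        · obtain ⟨he', hl'⟩ := Finset.mem_filter.1 he'
          rw [Finset.mem_sdiff, List.mem_toFinset]
          exact ⟨h.fst_mem e he', hl'⟩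
        · rw [Finset.mem_sdiff, List.mem_toFinset] at hv
          obtain ⟨u, hu, huniq⟩ := h.existsUnique_out v hv.1
          exact ⟨u, Finset.mem_filter.2 ⟨hu, hv.2⟩,
            fun u' hu' => huniq u' (Finset.mem_filter.1 hu').1⟩
        · exact h.acyclic v (Relation.TransGen.mono
            (fun x y hxy => (Finset.mem_filter.1 hxy).1) v v hv)
      have hsub : U \ (l :: q).toFinset ⊂ U :=
        (Finset.ssubset_iff_of_subset Finset.sdiff_subset).2 ⟨l, hl, by simp⟩
      obtain ⟨ps, hps⟩ := ih _ hsub hF'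
      have hF : F = (pathEdges (l :: (q ++ [w]))).toFinset ∪ F' := by
        ext e
        simp only [Finset.mem_union, List.mem_toFinset, F', Finset.mem_filter]
        refine ⟨fun hmem => ?_, fun hmem => hmem.elim (he e) And.left⟩
        by_cases hlq : e.1 ∈ l :: q
        · obtain ⟨u, hu⟩ := exists_mem_pathEdges_left (w := w) hlq
          obtain rfl : u = e.2 := h.eq_of_mem (he _ hu) hmem
          exact Or.inl hu
        · exact Or.inr ⟨hmem, hlq⟩
      rw [hF]
      exact ⟨_, .cons hl (fun u hu => U.min'_le u hu) hn hq hw hps⟩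

end Branches

/-! ### Trimming -/

section Trimming

variable {α : Type*} [LinearOrder α]

theorem IsTrimPath.unique {roots : Set α} {F : Finset (α × α)}
    (hF : ∀ v w w', (v, w) ∈ F → (v, w') ∈ F → w = w') {p p' : List α}
    (h : IsTrimPath roots F p) (h' : IsTrimPath roots F p') : p = p' := by
  obtain ⟨l, q, w, rfl, hl, he, hq, hw⟩ := h
  obtain ⟨l', q', w', rfl, hl', he', hq', hw'⟩ := h'
  obtain rfl := hl.unique hl'
  have key : ∀ (x : α) (q q' : List α), (∀ e ∈ pathEdges (x :: (q ++ [w])), e ∈ F) →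
      (∀ e ∈ pathEdges (x :: (q' ++ [w'])), e ∈ F) → (∀ v ∈ q, ¬ IsStop roots F l v) →
      (∀ v ∈ q', ¬ IsStop roots F l v) → q ++ [w] = q' ++ [w'] := by
    intro x q
    induction q generalizing x with
    | nil =>
      intro q' h1 h2 _ h4
      cases q' with
      | nil =>
        have := hF x w w' (h1 _ (by simp [pathEdges])) (h2 _ (by simp [pathEdges]))
        simp [this]
      | cons y q' =>
        have := hF x w y (h1 _ (by simp [pathEdges])) (h2 _ (by simp [pathEdges]))
        exact absurd (this ▸ hw) (h4 y List.mem_cons_self)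
    | cons z q ih =>
      intro q' h1 h2 h3 h4
      cases q' with
      | nil =>
        have := hF x z w' (h1 _ (by simp [pathEdges])) (h2 _ (by simp [pathEdges]))
        exact absurd (this ▸ hw') (h3 z List.mem_cons_self)
      | cons y q' =>
        obtain rfl := hF x z y (h1 _ (by simp [pathEdges])) (h2 _ (by simp [pathEdges]))
        rw [List.cons_append, List.cons_append, ih z q'
          (fun e h => h1 e (List.mem_cons_of_mem _ h)) (fun e h => h2 e (List.mem_cons_of_mem _ h))
          (fun v h => h3 v (List.mem_cons_of_mem _ h)) (fun v h => h4 v (List.mem_cons_of_mem _ h))]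
  rw [key l q q' he he' hq hq']

theorem TrimRun.unique {roots : Set α} {F : Finset (α × α)}
    (hF : ∀ v w w', (v, w) ∈ F → (v, w') ∈ F → w = w') {ps ps' : List (List α)}
    (h : TrimRun roots F ps) (h' : TrimRun roots F ps') : ps = ps' := by
  induction h generalizing ps' with
  | done =>
    cases h' with
    | done => rfl
    | step hne => simp at hne
  | step hne hp _ ih =>
    cases h' with
    | done => simp at hne
    | step _ hp' hr =>
      obtain rfl := hp.unique hF hp'
      rw [ih (fun v w w' h h' => hF v w w' (Finset.mem_sdiff.1 h).1 (Finset.mem_sdiff.1 h').1) hr]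

/-- Suppose that a branch from the smallest vertex `l` of `U` to the outside of `U` has been split
off. Trimming the rest `F` relative to the enlarged root set is the same as trimming the whole
configuration, and the branch is the path trimmed last: a vertex of the branch at which a path of
`F` arrives is smaller than all leaves of `F` (if it is `l`) or a fork (otherwise). -/
theorem TrimRun.append_branch {U : Finset α} {l w : α} {q : List α} (hl : l ∈ U)
    (hmin : ∀ u ∈ U, l ≤ u) (hn : (l :: q).Nodup) (hq : ∀ v ∈ q, v ∈ U) (hw : w ∉ U)
    {F : Finset (α × α)} {ps : List (List α)} (hF : ∀ e ∈ F, e.1 ∈ U \ (l :: q).toFinset)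
    (h : TrimRun ((U \ (l :: q).toFinset : Finset α) : Set α)ᶜ F ps) :
    TrimRun (U : Set α)ᶜ ((pathEdges (l :: (q ++ [w]))).toFinset ∪ F)
      (ps ++ [l :: (q ++ [w])]) := by
  have hN := nodup_append_of_notMem hl hn hq hw
  -- Neither the branch nor its end has an edge into the rest of `U`.
  have hout : ∀ u v, (u, v) ∈ pathEdges (l :: (q ++ [w])) → v ∉ U \ (l :: q).toFinset := by
    intro u v huv hv
    rw [Finset.mem_sdiff, List.mem_toFinset] at hv
    rcases List.mem_append.1 (snd_mem_of_mem_pathEdges huv) with h' | h'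
    · exact hv.2 (List.mem_cons_of_mem _ h')
    · exact hw (List.mem_singleton.1 h' ▸ hv.1)
  generalize hR : ((U \ (l :: q).toFinset : Finset α) : Set α)ᶜ = R at h
  induction h with
  | done =>
    refine .step ⟨_, Finset.mem_union_left _ (List.mem_toFinset.2
      (exists_mem_pathEdges_left List.mem_cons_self).choose_spec)⟩ ?_ (by simpa using .done)
    rw [Finset.union_empty]
    refine ⟨l, q, w, rfl, ⟨⟨?_, ?_⟩, ?_⟩, fun e he => List.mem_toFinset.2 he, ?_, Or.inl hw⟩
    · exact (exists_mem_pathEdges_left List.mem_cons_self).imp fun _ => List.mem_toFinset.2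
    · intro u hu
      exact (List.nodup_cons.1 hN).1 (snd_mem_of_mem_pathEdges (List.mem_toFinset.1 hu))
    · rintro v ⟨⟨u, hu⟩, hv⟩
      rcases List.mem_cons.1 (fst_mem_of_mem_pathEdges (List.mem_toFinset.1 hu)) with h' | h'
      · exact h'.le
      · obtain ⟨u', hu'⟩ := exists_mem_pathEdges_right (x := l) (List.mem_append_left [w] h')
        exact absurd (List.mem_toFinset.2 hu') (hv u')
    · rintro v hv (h' | ⟨u₁, u₂, hne, h₁, h₂⟩ | h')
      · exact h' (hq v hv)
      · exact hne (eq_of_mem_pathEdges_right (List.nodup_cons.1 hN).2 (List.mem_toFinset.1 h₁)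
          (List.mem_toFinset.1 h₂))
      · exact (hmin v (hq v hv)).not_gt h'
  | @step F p ps hne hp hrun ih =>
    subst hR
    have hpF : ∀ e ∈ pathEdges p, e ∈ F := by
      obtain ⟨l', q', w', rfl, -, he, -, -⟩ := hp
      exact he
    have hsdiff : ((pathEdges (l :: (q ++ [w]))).toFinset ∪ F) \ (pathEdges p).toFinset =
        (pathEdges (l :: (q ++ [w]))).toFinset ∪ (F \ (pathEdges p).toFinset) := by
      rw [Finset.union_sdiff_distrib, Finset.sdiff_eq_self_of_disjoint]
      refine Finset.disjoint_left.2 fun e he he' => ?_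
      have h1 := fst_mem_of_mem_pathEdges (List.mem_toFinset.1 he)
      have h2 := hF e (hpF e (List.mem_toFinset.1 he'))
      exact (Finset.mem_sdiff.1 h2).2 (List.mem_toFinset.2 h1)
    refine .step (hne.mono Finset.subset_union_right) ?_
      (hsdiff ▸ ih fun e he => hF e (Finset.mem_sdiff.1 he).1)
    obtain ⟨l', q', w', rfl, ⟨⟨⟨y, hy⟩, hin⟩, hmax⟩, he, hq', hw'⟩ := hp
    have hl' := hF _ hy
    have hl'U := Finset.mem_sdiff.1 hl'
    have hlt : l < l' := lt_of_le_of_ne (hmin l' hl'U.1) fun h => hl'U.2 (by simp [h])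
    refine ⟨l', q', w', rfl, ⟨⟨⟨y, Finset.mem_union_right _ hy⟩, ?_⟩, ?_⟩,
      fun e h' => Finset.mem_union_right _ (he e h'), ?_, ?_⟩
    · intro u hu
      rcases Finset.mem_union.1 hu with hu | hu
      · exact hout u l' (List.mem_toFinset.1 hu) hl'
      · exact hin u hu
    · rintro v ⟨⟨u, hu⟩, hv⟩
      rcases Finset.mem_union.1 hu with hu | hu
      · rcases List.mem_cons.1 (fst_mem_of_mem_pathEdges (List.mem_toFinset.1 hu)) with h' | h'
        · exact h'.le.trans hlt.le
        · obtain ⟨u', hu'⟩ := exists_mem_pathEdges_right (x := l) (List.mem_append_left [w] h')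
          exact absurd (Finset.mem_union_left _ (List.mem_toFinset.2 hu')) (hv u')
      · exact hmax ⟨⟨u, hu⟩, fun u' hu' => hv u' (Finset.mem_union_right _ hu')⟩
    · intro v hv hend
      have hvU : v ∈ U \ (l :: q).toFinset := by
        by_contra hc
        exact hq' v hv (Or.inl hc)
      rcases hend with h' | ⟨u₁, u₂, hne', h₁, h₂⟩ | h'
      · exact h' (Finset.mem_sdiff.1 hvU).1
      · refine hq' v hv (Or.inr (Or.inl ⟨u₁, u₂, hne', ?_, ?_⟩))
        · exact (Finset.mem_union.1 h₁).resolve_left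
            fun h' => hout _ _ (List.mem_toFinset.1 h') hvU
        · exact (Finset.mem_union.1 h₂).resolve_left
            fun h' => hout _ _ (List.mem_toFinset.1 h') hvU
      · exact hq' v hv (Or.inr (Or.inr h'))
    · rcases hw' with h' | ⟨u₁, u₂, hne', h₁, h₂⟩ | h'
      · by_cases hwU : w' ∈ U
        · have hmem : w' ∈ l :: q := by
            by_contra hc
            exact h' (Finset.mem_coe.2 (Finset.mem_sdiff.2 ⟨hwU, by simpa using hc⟩))
          -- The path of `F` arrives at the branch: at its first vertex or at a fork.
          rcases List.mem_cons.1 hmem with rfl | hmem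
          · exact Or.inr (Or.inr hlt)
          · obtain ⟨u, hu⟩ := exists_mem_pathEdges_right (x := l) (List.mem_append_left [w] hmem)
            obtain ⟨z, hz⟩ := exists_mem_pathEdges_right (x := l') (v := w') (t := q' ++ [w'])
              (by simp)
            refine Or.inr (Or.inl ⟨u, z, ?_, Finset.mem_union_left _ (List.mem_toFinset.2 hu),
              Finset.mem_union_right _ (he _ hz)⟩)
            rintro rfl
            exact (Finset.mem_sdiff.1 (hF _ (he _ hz))).2
              (List.mem_toFinset.2 (fst_mem_of_mem_pathEdges hu))
        · exact Or.inl hwU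
      · exact Or.inr (Or.inl ⟨u₁, u₂, hne', Finset.mem_union_right _ h₁,
          Finset.mem_union_right _ h₂⟩)
      · exact Or.inr (Or.inr h')

/-- The trimming algorithm produces the branches in reverse order. -/
theorem Branching.trimRun {U : Finset α} {F : Finset (α × α)} {ps : List (List α)}
    (h : Branching U F ps) : TrimRun (U : Set α)ᶜ F ps.reverse := by
  induction h with
  | nil => exact .done
  | cons hl hmin hn hq hw hF ih =>
    rw [List.reverse_cons]
    exact ih.append_branch hl hmin hn hq hw hF.isForestOn.fst_mem

/-- `F` is a forest on `U` whose branches all have even length. -/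
def EvenBranching (U : Finset α) (F : Finset (α × α)) : Prop :=
  ∃ ps, Branching U F ps ∧ ∀ p ∈ ps, Even (pathEdges p).length

/-- Condition (C) is a condition on the branches: the algorithm is deterministic, so its paths are
the branches. -/
theorem isForestOn_and_conditionC_iff [Finite α] {U : Finset α} {F : Finset (α × α)} :
    IsForestOn U F ∧ ConditionC (U : Set α)ᶜ F ↔ EvenBranching U F := by
  constructor
  · rintro ⟨hF, ps, hps, heven⟩
    obtain ⟨ps', hps'⟩ := hF.exists_branching
    obtain rfl := hps.unique (fun _ _ _ => hF.eq_of_mem) hps'.trimRun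
    exact ⟨ps', hps', fun p hp => heven p (List.mem_reverse.2 hp)⟩
  · rintro ⟨ps, hps, heven⟩
    exact ⟨hps.isForestOn, ps.reverse, hps.trimRun, fun p hp => heven p (List.mem_reverse.1 hp)⟩

end Trimming

/-! ### The weighted sum over even branchings -/

section WeightSum

variable {α K : Type*} [Fintype α] [CommRing K]

open Classical in
/-- The weighted count of the edge sets with a given property. -/
noncomputable def weightSum (a : Matrix α α K) (P : Finset (α × α) → Prop) : K :=
  ∑ F with P F, ∏ e ∈ F, a e.1 e.2

theorem weightSum_congr (a : Matrix α α K) {P P' : Finset (α × α) → Prop}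
    (h : ∀ F, P F ↔ P' F) : weightSum a P = weightSum a P' := by
  rw [funext fun F => propext (h F)]

theorem weightSum_false (a : Matrix α α K) : weightSum a (fun _ => False) = 0 := by
  simp [weightSum]

end WeightSum

section Sum

variable {α : Type*} [LinearOrder α]

theorem EvenBranching.fst_mem {U : Finset α} {F : Finset (α × α)} (h : EvenBranching U F) :
    ∀ e ∈ F, e.1 ∈ U :=
  h.choose_spec.1.isForestOn.fst_mem

theorem evenBranching_empty_iff {F : Finset (α × α)} : EvenBranching ∅ F ↔ F = ∅ := by
  constructor
  · exact fun h => Finset.eq_empty_of_forall_notMem fun e he => by simpa using h.fst_mem e he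
  · rintro rfl
    exact ⟨[], .nil, by simp⟩

/-- While the first branch of a forest on `U` is being drawn, let `x` be its current end and `W` the
set of vertices not yet visited. `Completes U W x F` says that `F` consists of the remaining part of
the branch, which leaves `U` when an even number of vertices remain unvisited, and of an even
branching on these vertices. -/
def Completes (U W : Finset α) (x : α) (F : Finset (α × α)) : Prop :=
  ∃ (q : List α) (w : α) (F' : Finset (α × α)), q.Nodup ∧ (∀ v ∈ q, v ∈ W) ∧ w ∉ U ∧
    Even (W \ q.toFinset).card ∧ EvenBranching (W \ q.toFinset) F' ∧
    F = (pathEdges (x :: (q ++ [w]))).toFinset ∪ F'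

theorem Completes.fst_mem {U W : Finset α} {x : α} {F : Finset (α × α)}
    (h : Completes U W x F) : ∀ e ∈ F, e.1 = x ∨ e.1 ∈ W := by
  obtain ⟨q, w, F', -, hq, -, -, hF', rfl⟩ := h
  intro e he
  rcases Finset.mem_union.1 he with he | he
  · rcases List.mem_cons.1 (fst_mem_of_mem_pathEdges (List.mem_toFinset.1 he)) with h | h
    exacts [Or.inl h, Or.inr (hq _ h)]
  · exact Or.inr (Finset.mem_sdiff.1 (hF'.fst_mem e he)).1

theorem sdiff_cons_toFinset (U : Finset α) (l : α) (q : List α) :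
    U \ (l :: q).toFinset = U.erase l \ q.toFinset := by
  rw [List.toFinset_cons, Finset.sdiff_insert, Finset.erase_sdiff_comm]

/-- The first branch starts at `l`; since `U` has an even number of vertices, the branch has even
length if and only if it leaves an even number of them unvisited. -/
theorem evenBranching_iff_completes {U : Finset α} (hU : Even U.card) {l : α} (hl : l ∈ U)
    (hmin : ∀ u ∈ U, l ≤ u) {F : Finset (α × α)} :
    EvenBranching U F ↔ Completes U (U.erase l) l F := by
  have hpos := Finset.card_pos.2 ⟨l, hl⟩
  have hparity : ∀ q : List α, q.Nodup → (∀ v ∈ q, v ∈ U.erase l) →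
      (Even (q.length + 1) ↔ Even (U.erase l \ q.toFinset).card) := by
    intro q hn hq
    have hsub : q.toFinset ⊆ U.erase l := fun v hv => hq v (List.mem_toFinset.1 hv)
    have h2 := Finset.card_le_card hsub
    rw [Finset.card_sdiff_of_subset hsub]
    rw [Finset.card_erase_of_mem hl, List.toFinset_card_of_nodup hn] at *
    grind
  constructor
  · rintro ⟨ps, hps, heven⟩
    cases hps with
    | nil => simp at hl
    | @cons _ F ps l' w q hl' hmin' hn hq hw hF =>
      obtain rfl : l = l' := le_antisymm (hmin l' hl') (hmin' l hl)
      rw [List.nodup_cons] at hn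
      rw [sdiff_cons_toFinset] at hF
      have hq' : ∀ v ∈ q, v ∈ U.erase l := fun v hv =>
        Finset.mem_erase.2 ⟨fun h => hn.1 (h ▸ hv), hq v hv⟩
      have h1 := heven _ List.mem_cons_self
      rw [length_pathEdges_cons, List.length_append, List.length_singleton] at h1
      exact ⟨q, w, F, hn.2, hq', hw, (hparity q hn.2 hq').1 h1,
        ⟨ps, hF, fun p hp => heven p (List.mem_cons_of_mem _ hp)⟩, rfl⟩
  · rintro ⟨q, w, F', hn, hq, hw, hcard, ⟨ps, hps, heven⟩, rfl⟩
    rw [← sdiff_cons_toFinset] at hps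
    refine ⟨_, .cons hl hmin (List.nodup_cons.2 ⟨fun h => by simpa using hq l h, hn⟩)
      (fun v hv => Finset.mem_of_mem_erase (hq v hv)) hw hps, fun p hp => ?_⟩
    rcases List.mem_cons.1 hp with rfl | hp
    · rw [length_pathEdges_cons, List.length_append, List.length_singleton]
      exact (hparity q hn hq).2 hcard
    · exact heven p hp

/-- `AfterStep U W w F`: the edges `F` are a valid continuation once the branch has stepped to
`w`. -/
def AfterStep (U W : Finset α) (w : α) (F : Finset (α × α)) : Prop :=
  (w ∈ W ∧ Completes U (W.erase w) w F) ∨ (w ∉ U ∧ Even W.card ∧ EvenBranching W F)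

theorem AfterStep.fst_mem {U W : Finset α} {w : α} {F : Finset (α × α)}
    (h : AfterStep U W w F) : ∀ e ∈ F, e.1 ∈ W := by
  rcases h with ⟨hw, h⟩ | ⟨-, -, h⟩
  · intro e he
    rcases h.fst_mem e he with h | h
    exacts [h ▸ hw, Finset.mem_of_mem_erase h]
  · exact h.fst_mem

theorem completes_iff_exists_afterStep {U W : Finset α} {x : α} {F : Finset (α × α)} :
    Completes U W x F ↔ ∃ w F', AfterStep U W w F' ∧ F = insert (x, w) F' := by
  constructor
  · rintro ⟨q, w, F', hn, hq, hw, hcard, hF', rfl⟩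
    cases q with
    | nil =>
      refine ⟨w, F', Or.inr ⟨hw, by simpa using hcard, by simpa using hF'⟩, ?_⟩
      ext
      simp [pathEdges]
    | cons y q =>
      rw [List.nodup_cons] at hn
      rw [sdiff_cons_toFinset] at hcard hF'
      refine ⟨y, _, Or.inl ⟨hq y List.mem_cons_self, q, w, F', hn.2, fun v hv =>
        Finset.mem_erase.2 ⟨fun h => hn.1 (h ▸ hv), hq v (List.mem_cons_of_mem _ hv)⟩, hw, hcard,
        hF', rfl⟩, ?_⟩
      rw [List.cons_append, pathEdges_cons_cons, List.toFinset_cons, Finset.insert_union]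
  · rintro ⟨y, F', ⟨hy, q, w, F'', hn, hq, hw, hcard, hF'', rfl⟩ | ⟨hy, hcard, hF'⟩, rfl⟩
    · refine ⟨y :: q, w, F'', List.nodup_cons.2 ⟨fun h => by simpa using hq y h, hn⟩, ?_, hw, ?_,
        ?_, ?_⟩
      · intro v hv
        rcases List.mem_cons.1 hv with rfl | hv
        exacts [hy, Finset.mem_of_mem_erase (hq v hv)]
      · rwa [sdiff_cons_toFinset]
      · rwa [sdiff_cons_toFinset]
      · rw [List.cons_append, pathEdges_cons_cons, List.toFinset_cons, Finset.insert_union]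
    · refine ⟨[], y, F', List.nodup_nil, by simp, hy, by simpa using hcard, by simpa using hF', ?_⟩
      ext
      simp [pathEdges]

variable [Fintype α] {K : Type*}

/-- The edge of `F` that starts at `x` determines the next step, so the sum splits over the
steps. -/
theorem weightSum_completes [CommRing K] (a : Matrix α α K) {U W : Finset α} {x : α} (hx : x ∉ W) :
    weightSum a (Completes U W x) = ∑ w, a x w * weightSum a (AfterStep U W w) := by
  classical
  have hmem : ∀ {w F}, AfterStep U W w F → ∀ w', (x, w') ∉ F := fun h w' h' =>
    hx (h.fst_mem _ h')
  simp only [weightSum, Finset.mul_sum]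
  rw [Finset.sum_sigma']
  symm
  refine Finset.sum_bij (fun s _ => insert (x, s.1) s.2) ?_ ?_ ?_ ?_
  · rintro ⟨w, F⟩ h
    simp only [Finset.mem_sigma, Finset.mem_univ, Finset.mem_filter, true_and] at h ⊢
    exact completes_iff_exists_afterStep.2 ⟨w, F, h, rfl⟩
  · rintro ⟨w, F⟩ h ⟨w', F'⟩ h' heq
    simp only [Finset.mem_sigma, Finset.mem_univ, Finset.mem_filter, true_and] at h h' heq
    have hw : (x, w) ∈ insert (x, w') F' := heq ▸ Finset.mem_insert_self _ _
    obtain rfl : w = w' := by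
      rcases Finset.mem_insert.1 hw with h1 | h1
      exacts [congrArg Prod.snd h1, absurd h1 (hmem h' w)]
    rw [← Finset.erase_insert (hmem h w), heq, Finset.erase_insert (hmem h' w)]
  · intro F hF
    simp only [Finset.mem_univ, Finset.mem_filter, true_and] at hF
    obtain ⟨w, F', h, rfl⟩ := completes_iff_exists_afterStep.1 hF
    exact ⟨⟨w, F'⟩, by simpa using h, rfl⟩
  · rintro ⟨w, F⟩ h
    simp only [Finset.mem_sigma, Finset.mem_univ, Finset.mem_filter, true_and] at h
    rw [Finset.prod_insert (hmem h w)]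

/-- One step of a branch at `x`: it moves to an unvisited vertex or leaves `U`. Since the row of `x`
sums to zero, the total weight for leaving `U` is minus the sum over `U`. -/
theorem weightSum_completes_step [CommRing K] {a : Matrix α α K} (hrow : ∀ i, ∑ j, a i j = 0)
    {U W : Finset α} (hWU : W ⊆ U) {x : α} (hx : x ∉ W) :
    weightSum a (Completes U W x) =
      (-∑ s ∈ U, a x s) * (if Even W.card then weightSum a (EvenBranching W) else 0) +
        ∑ u ∈ W, a x u * weightSum a (Completes U (W.erase u) u) := by
  classical
  rw [weightSum_completes a hx, ← Finset.sum_compl_add_sum U]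
  have hexit : ∑ s ∈ Uᶜ, a x s = -∑ s ∈ U, a x s :=
    eq_neg_of_add_eq_zero_left ((Finset.sum_compl_add_sum U _).trans (hrow x))
  congr 1
  · rw [← hexit, Finset.sum_mul]
    refine Finset.sum_congr rfl fun w hw => ?_
    rw [Finset.mem_compl] at hw
    congr 1
    have hw' : w ∉ W := fun h => hw (hWU h)
    split_ifs with hW
    · exact weightSum_congr a fun F => by simp [AfterStep, hw, hw', hW]
    · rw [← weightSum_false a]
      exact weightSum_congr a fun F => by simp [AfterStep, hw', hW]
  · rw [← Finset.sum_subset hWU]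
    · refine Finset.sum_congr rfl fun u hu => ?_
      congr 1
      exact weightSum_congr a fun F => by simp [AfterStep, hu, hWU hu]
    · intro u hu hu'
      rw [weightSum_congr a (P' := fun _ => False) fun F => by simp [AfterStep, hu, hu'],
        weightSum_false, mul_zero]

/-- The weight of all completions of a branch which has reached `x` is, up to sign, the sum of the
bordered determinants with row `x` and column any of the visited vertices. Both sides satisfy the
same recursion in `W`: in a bordered determinant, expand along the row `x`; when the branch leaves
`U`, use the vanishing row sum. The parity condition on leaving is invisible in the determinants,
because those of odd order vanish. -/
theorem weightSum_completes_eq [Field K] [CharZero K] {a : Matrix α α K} (hskew : a.transpose = -a)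
    (hrow : ∀ i, ∑ j, a i j = 0) {U : Finset α}
    (hU : ∀ W ⊂ U, Even W.card → weightSum a (EvenBranching W) = subDet a W)
    {W : Finset α} (hWU : W ⊆ U) {x : α} (hxU : x ∈ U) (hxW : x ∉ W) :
    weightSum a (Completes U W x) =
      (-1) ^ (W.card + 1) * ∑ s ∈ U \ W, borderedDet a W x s := by
  induction W using Finset.strongInduction generalizing x with
  | H W ih =>
    have hss : W ⊂ U := (Finset.ssubset_iff_of_subset hWU).2 ⟨x, hxU, hxW⟩
    -- After a step to `u`, the newly visited vertex `u` contributes `subDet a W`.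
    have hstep : ∀ u ∈ W, weightSum a (Completes U (W.erase u) u) =
        (-1) ^ W.card * (subDet a W + ∑ s ∈ U \ W, borderedDet a (W.erase u) u s) := by
      intro u hu
      rw [ih _ (Finset.erase_ssubset hu) ((Finset.erase_subset u W).trans hWU) (hWU hu)
        (Finset.notMem_erase u W), Finset.card_erase_add_one hu, Finset.sdiff_erase (hWU hu),
        Finset.sum_insert (by simp [hu]), borderedDet_erase_self a hu]
    have hexit : (if Even W.card then weightSum a (EvenBranching W) else 0) =
        (-1) ^ W.card * subDet a W := by
      split_ifs with h
      · rw [hU W hss h, h.neg_one_pow, one_mul]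
      · rw [subDet_eq_zero_of_odd hskew (Nat.not_even_iff_odd.1 h), mul_zero]
    have hcont : ∑ u ∈ W, a x u * weightSum a (Completes U (W.erase u) u) =
        (-1) ^ W.card * ((∑ u ∈ W, a x u) * subDet a W +
          ∑ u ∈ W, ∑ s ∈ U \ W, a x u * borderedDet a (W.erase u) u s) := by
      rw [Finset.sum_mul, ← Finset.sum_add_distrib, Finset.mul_sum]
      refine Finset.sum_congr rfl fun u hu => ?_
      rw [hstep u hu, ← Finset.mul_sum]
      ring
    have hexpand : ∑ s ∈ U \ W, borderedDet a W x s = (∑ s ∈ U \ W, a x s) * subDet a W -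
        ∑ u ∈ W, ∑ s ∈ U \ W, a x u * borderedDet a (W.erase u) u s := by
      rw [Finset.sum_congr rfl fun s _ => borderedDet_eq_sub_sum a W x s,
        Finset.sum_sub_distrib, Finset.sum_comm, Finset.sum_mul]
    rw [weightSum_completes_step hrow hWU hxW, hexit, hcont, hexpand, ← Finset.sum_sdiff hWU]
    ring

/-- The starting vertex `l` of the first branch is the only vertex visited at first, and the
bordered determinant with row and column `l` is the determinant on `U`. -/
theorem weightSum_evenBranching [Field K] [CharZero K] {a : Matrix α α K} (hskew : a.transpose = -a)
    (hrow : ∀ i, ∑ j, a i j = 0) {U : Finset α} (hcard : Even U.card) :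
    weightSum a (EvenBranching U) = subDet a U := by
  induction U using Finset.strongInduction with
  | H U ih =>
    rcases U.eq_empty_or_nonempty with rfl | hne
    · rw [subDet_empty, weightSum]
      simp [evenBranching_empty_iff, Finset.filter_eq']
    · have hl := U.min'_mem hne
      rw [weightSum_congr a fun F => evenBranching_iff_completes hcard hl fun u hu =>
        U.min'_le u hu, weightSum_completes_eq hskew hrow ih (Finset.erase_subset _ _) hl
        (Finset.notMem_erase _ _), Finset.card_erase_add_one hl, hcard.neg_one_pow, one_mul,
        Finset.sdiff_erase hl]
      simp [borderedDet_erase_self a hl]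

end Sum

/-! ### Alternating branches and matchings -/

section Pairing

variable {α : Type*}

/-- Every other edge of the path with successive vertices `p`, beginning with the first. -/
def alternateEdges : List α → List (α × α)
  | x :: y :: t => (x, y) :: alternateEdges t
  | _ => []

theorem mem_pathEdges_of_mem_alternateEdges {p : List α} {e : α × α} (h : e ∈ alternateEdges p) :
    e ∈ pathEdges p := by
  induction p using alternateEdges.induct with
  | case1 x y t ih =>
    rw [alternateEdges, List.mem_cons] at h
    rw [pathEdges_cons_cons, List.mem_cons]
    refine h.imp_right fun h => ?_
    cases t with
    | nil => simp [alternateEdges] at h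
    | cons z t => exact List.mem_cons_of_mem _ (ih h)
  | case2 p h' =>
    rw [alternateEdges.eq_2 p h'] at h
    simp at h

/-- If the edge set `E` of a path is such that `M` contains with each edge the next but one, and `M`
contains the first edge, then `M` contains every other edge. -/
theorem alternateEdges_subset {M : α → α → Prop} {E : Set (α × α)}
    (hstep : ∀ x y z z', (x, y) ∈ E → (y, z) ∈ E → (z, z') ∈ E → M x y → M z z') {p : List α}
    (hE : ∀ e ∈ pathEdges p, e ∈ E) (hhead : ∀ e, (pathEdges p).head? = some e → M e.1 e.2) :
    ∀ e ∈ alternateEdges p, M e.1 e.2 := by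
  induction p using alternateEdges.induct with
  | case1 x y t ih =>
    have hxy : M x y := hhead (x, y) rfl
    intro e he
    rw [alternateEdges, List.mem_cons] at he
    rcases he with rfl | he
    · exact hxy
    · cases t with
      | nil => simp [alternateEdges] at he
      | cons z t =>
        simp only [pathEdges_cons_cons, List.mem_cons, forall_eq_or_imp] at hE
        refine ih hE.2.2 (fun e he => ?_) e he
        cases t with
        | nil => simp [pathEdges] at he
        | cons z' t =>
          obtain rfl : (z, z') = e := by simpa [pathEdges] using he
          exact hstep x y z z' hE.1 hE.2.1 (hE.2.2 _ List.mem_cons_self) hxy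
  | case2 p h' =>
    rw [alternateEdges.eq_2 p h']
    simp

/-- The edges `m` form a perfect matching of the vertices in `U`. -/
structure IsPairing (U : Finset α) (m : Set (α × α)) : Prop where
  mem : ∀ e ∈ m, e.1 ∈ U ∧ e.2 ∈ U
  ne : ∀ e ∈ m, e.1 ≠ e.2
  exists_mem : ∀ v ∈ U, ∃ e ∈ m, v = e.1 ∨ v = e.2
  eq_of_mem : ∀ e ∈ m, ∀ e' ∈ m, ∀ v, v = e.1 ∨ v = e.2 → v = e'.1 ∨ v = e'.2 → e = e'

theorem IsPairing.union [DecidableEq α] {U U' : Finset α} {m m' : Set (α × α)}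
    (h : IsPairing U m) (h' : IsPairing U' m') (hd : Disjoint U U') :
    IsPairing (U ∪ U') (m ∪ m') := by
  have hmem : ∀ e ∈ m, ∀ v, v = e.1 ∨ v = e.2 → v ∈ U := by
    rintro e he v (rfl | rfl)
    exacts [(h.mem e he).1, (h.mem e he).2]
  have hmem' : ∀ e ∈ m', ∀ v, v = e.1 ∨ v = e.2 → v ∈ U' := by
    rintro e he v (rfl | rfl)
    exacts [(h'.mem e he).1, (h'.mem e he).2]
  refine ⟨?_, ?_, ?_, ?_⟩
  · rintro e (he | he)
    · exact (h.mem e he).imp (Finset.mem_union_left _) (Finset.mem_union_left _)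
    · exact (h'.mem e he).imp (Finset.mem_union_right _) (Finset.mem_union_right _)
  · rintro e (he | he)
    exacts [h.ne e he, h'.ne e he]
  · intro v hv
    rcases Finset.mem_union.1 hv with hv | hv
    · exact (h.exists_mem v hv).imp fun e he => he.imp_left Or.inl
    · exact (h'.exists_mem v hv).imp fun e he => he.imp_left Or.inr
  · rintro e (he | he) e' (he' | he') v hv hv'
    · exact h.eq_of_mem e he e' he' v hv hv'
    · exact absurd (hmem' _ he' v hv') (Finset.disjoint_left.1 hd (hmem _ he v hv))
    · exact absurd (hmem' _ he v hv) (Finset.disjoint_left.1 hd (hmem _ he' v hv'))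
    · exact h'.eq_of_mem e he e' he' v hv hv'

theorem isPairing_pair [DecidableEq α] {x y : α} (h : x ≠ y) : IsPairing {x, y} {(x, y)} := by
  refine ⟨?_, ?_, ?_, ?_⟩
  · rintro e rfl
    simp
  · rintro e rfl
    exact h
  · intro v hv
    exact ⟨(x, y), rfl, by simpa using hv⟩
  · rintro e rfl e' rfl _ _ _
    rfl

/-- The last vertex of a path of even length is not covered. -/
theorem isPairing_alternateEdges [DecidableEq α] {l : List α} (hl : l.Nodup) (heven : Even l.length)
    (w : α) : IsPairing l.toFinset {e | e ∈ alternateEdges (l ++ [w])} := by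
  induction l using alternateEdges.induct with
  | case1 x y t ih =>
    rw [List.nodup_cons, List.nodup_cons] at hl
    have hxy : x ≠ y := fun h => hl.1 (h ▸ List.mem_cons_self)
    have h := (isPairing_pair hxy).union (ih hl.2.2 (by
      simpa [Nat.even_add_one, parity_simps] using heven)) (by
        rw [Finset.disjoint_left]
        intro v hv hv'
        rw [List.mem_toFinset] at hv'
        rcases Finset.mem_insert.1 hv with rfl | hv
        · exact hl.1 (List.mem_cons_of_mem _ hv')
        · exact hl.2.1 (Finset.mem_singleton.1 hv ▸ hv'))
    convert h using 1
    · ext v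
      simp
    · ext e
      simp [alternateEdges]
  | case2 l h' =>
    match l, h', heven with
    | [], _, _ => exact ⟨by simp [alternateEdges], by simp [alternateEdges], by simp,
        by simp [alternateEdges]⟩
    | [x], _, heven => simp at heven
    | x :: y :: t, h', _ => exact absurd rfl (h' x y t)

/-- The union of the alternate edges of the paths `ps`. -/
def pathMatching (ps : List (List α)) : Set (α × α) :=
  {e | ∃ p ∈ ps, e ∈ alternateEdges p}

theorem pathMatching_cons (p : List α) (ps : List (List α)) :
    pathMatching (p :: ps) = {e | e ∈ alternateEdges p} ∪ pathMatching ps := by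
  ext e
  simp [pathMatching]

variable [LinearOrder α]

theorem Branching.mem_of_mem_pathMatching {U : Finset α} {F : Finset (α × α)} {ps : List (List α)}
    (h : Branching U F ps) : ∀ e ∈ pathMatching ps, e ∈ F := by
  induction h with
  | nil => simp [pathMatching]
  | cons hl hmin hn hq hw hF ih =>
    rw [pathMatching_cons]
    rintro e (he | he)
    · exact Finset.mem_union_left _ (List.mem_toFinset.2 (mem_pathEdges_of_mem_alternateEdges he))
    · exact Finset.mem_union_right _ (ih e he)

/-- A branch of even length ends at a vertex outside `U` or on a previous branch, and its other
vertices are covered by its alternate edges. -/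
theorem Branching.isPairing {U : Finset α} {F : Finset (α × α)} {ps : List (List α)}
    (h : Branching U F ps) (heven : ∀ p ∈ ps, Even (pathEdges p).length) :
    IsPairing U (pathMatching ps) := by
  induction h with
  | nil => exact ⟨by simp [pathMatching], by simp [pathMatching], by simp, by simp [pathMatching]⟩
  | @cons U F ps l w q hl hmin hn hq hw hF ih =>
    rw [pathMatching_cons]
    have h1 := heven _ List.mem_cons_self
    rw [length_pathEdges_cons, List.length_append, List.length_singleton] at h1
    have h := (isPairing_alternateEdges hn h1 w).union
      (ih fun p hp => heven p (List.mem_cons_of_mem _ hp)) Finset.disjoint_sdiff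
    rwa [Finset.union_sdiff_of_subset] at h
    intro v hv
    rcases List.mem_cons.1 (List.mem_toFinset.1 hv) with rfl | hv
    exacts [hl, hq v hv]

/-- Let `M` be a perfect matching of `U` all of whose edges are edges of `F`. If all branches start
with an edge of `M`, then they alternate between edges of `M` and other edges. Indeed, consider the
vertex `z` reached by two steps, the first of which is in `M`. Its partner in `M` is not the
preceding vertex, and not a vertex outside the branch, since these are matched among themselves; so
it is the next vertex. -/
theorem Branching.pathMatching_subset {M : α → α → Prop} (hsymm : ∀ u v, M u v → M v u)
    (huniq : ∀ v u u', M v u → M v u' → u = u') {U : Finset α} {F : Finset (α × α)}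
    {ps : List (List α)} (h : Branching U F ps) (heven : ∀ p ∈ ps, Even (pathEdges p).length)
    (hhead : ∀ p ∈ ps, ∀ e, (pathEdges p).head? = some e → M e.1 e.2)
    (hM : ∀ v ∈ U, ∃ u, M v u ∧ ((v, u) ∈ F ∨ (u, v) ∈ F)) :
    ∀ e ∈ pathMatching ps, M e.1 e.2 := by
  induction h with
  | nil => simp [pathMatching]
  | @cons U F ps l w q hl hmin hn hq hw hF ih =>
    have hlq : ∀ v ∈ l :: q, v ∈ U := by
      intro v hv
      rcases List.mem_cons.1 hv with rfl | hv
      exacts [hl, hq v hv]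
    have hforest := (Branching.cons hl hmin hn hq hw hF).isForestOn
    have hpair := hF.isPairing fun p hp => heven p (List.mem_cons_of_mem _ hp)
    have hrest := ih (fun p hp => heven p (List.mem_cons_of_mem _ hp))
      (fun p hp => hhead p (List.mem_cons_of_mem _ hp)) <| by
        intro v hv
        obtain ⟨hvU, hvq⟩ := Finset.mem_sdiff.1 hv
        rw [List.mem_toFinset] at hvq
        obtain ⟨u, hu, h'⟩ := hM v hvU
        simp only [Finset.mem_union, List.mem_toFinset] at h'
        refine ⟨u, hu, h'.imp (fun h' => h'.resolve_left fun h' => hvq ?_)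
          (fun h' => h'.resolve_left fun h' => ?_)⟩
        · exact fst_mem_of_mem_pathEdges h'
        · rcases List.mem_append.1 (snd_mem_of_mem_pathEdges h') with h' | h'
          · exact hvq (List.mem_cons_of_mem _ h')
          · exact hw (List.mem_singleton.1 h' ▸ hvU)
    -- The vertices outside the first branch are matched by `M` among themselves.
    have hmatched : ∀ u z, u ∈ U \ (l :: q).toFinset → M u z → z ∈ U \ (l :: q).toFinset := by
      intro u z hu huz
      obtain ⟨e, he, rfl | rfl⟩ := hpair.exists_mem u hu
      · exact huniq _ _ _ (hrest e he) huz ▸ (hpair.mem e he).2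
      · exact huniq _ _ _ (hsymm _ _ (hrest e he)) huz ▸ (hpair.mem e he).1
    rw [pathMatching_cons]
    rintro e (he | he)
    · refine alternateEdges_subset (E := {e | e ∈ pathEdges (l :: (q ++ [w]))}) ?_
        (fun e he => he) (hhead _ List.mem_cons_self) e he
      intro x y z z' hxy hyz hzz' hMxy
      have hz : z ∈ l :: q := fst_mem_of_mem_pathEdges hzz'
      obtain ⟨u, hu, h' | h'⟩ := hM z (hlq z hz)
      · exact hforest.eq_of_mem h' (Finset.mem_union_left _ (List.mem_toFinset.2 hzz')) ▸ hu
      · exfalso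
        rcases Finset.mem_union.1 h' with h' | h'
        · obtain rfl := eq_of_mem_pathEdges_right
            (List.nodup_cons.1 (nodup_append_of_notMem hl hn hq hw)).2 (List.mem_toFinset.1 h') hyz
          obtain rfl := huniq _ _ _ (hsymm _ _ hMxy) (hsymm _ _ hu)
          exact hforest.acyclic x (.tail
            (.single (Finset.mem_union_left _ (List.mem_toFinset.2 hxy)))
            (Finset.mem_union_left _ (List.mem_toFinset.2 hyz)))
        · have := hmatched u z (hF.isForestOn.fst_mem _ h') (hsymm _ _ hu)
          exact (Finset.mem_sdiff.1 this).2 (List.mem_toFinset.2 hz)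
    · exact hrest e he

theorem Branching.head_mem_pathMatching {U : Finset α} {F : Finset (α × α)} {ps : List (List α)}
    (h : Branching U F ps) {p : List α} (hp : p ∈ ps) :
    ∃ e, (pathEdges p).head? = some e ∧ e ∈ pathMatching ps := by
  induction h with
  | nil => simp at hp
  | @cons U F ps l w q hl hmin hn hq hw hF ih =>
    rw [pathMatching_cons]
    rcases List.mem_cons.1 hp with rfl | hp
    · cases q with
      | nil => exact ⟨(l, w), by simp [pathEdges], Or.inl (by simp [alternateEdges])⟩
      | cons y q => exact ⟨(l, y), by simp [pathEdges], Or.inl (by simp [alternateEdges])⟩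
    · exact (ih hp).imp fun e he => he.imp_right Or.inr

end Pairing

/-! ### Forests and matchings of a skew-symmetric matrix -/

section Main

variable {K : Type*} {n r : ℕ}

/-- The vertices that are not roots. -/
def nonRoots (n r : ℕ) : Finset (Fin (n + r)) :=
  Finset.univ.map (Fin.castAddEmb r)

theorem castAdd_mem_nonRoots (i : Fin n) : Fin.castAdd r i ∈ nonRoots n r :=
  Finset.mem_map_of_mem (Fin.castAddEmb r) (Finset.mem_univ i)

theorem exists_castAdd_eq {v : Fin (n + r)} (h : v ∈ nonRoots n r) :
    ∃ i, Fin.castAdd r i = v := by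
  simpa [nonRoots] using h

theorem rootSet_eq_compl : rootSet n r = (nonRoots n r : Set (Fin (n + r)))ᶜ := by
  ext v
  refine Fin.addCases (fun i => ?_) (fun i => ?_) v
  · simp only [Set.mem_compl_iff, Finset.mem_coe, castAdd_mem_nonRoots, not_true_eq_false,
      iff_false]
    rintro ⟨j, hj⟩
    have := congrArg Fin.val hj
    simp at this
    omega
  · refine ⟨fun _ h => ?_, fun _ => ⟨i, rfl⟩⟩
    obtain ⟨j, hj⟩ := exists_castAdd_eq (Finset.mem_coe.1 h)
    have := congrArg Fin.val hj
    simp at this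
    omega

theorem isSpanningForest_iff [Zero K] {a : Matrix (Fin (n + r)) (Fin (n + r)) K}
    {F : Finset (Fin (n + r) × Fin (n + r))} :
    IsSpanningForest a (rootSet n r) F ↔
      (∀ e ∈ F, a e.1 e.2 ≠ 0) ∧ IsForestOn (nonRoots n r) F := by
  rw [rootSet_eq_compl]
  constructor
  · intro h
    refine ⟨fun e he => h.edge_mem _ _ he, fun e he => ?_, fun v hv => ?_, h.acyclic⟩
    · by_contra hc
      exact h.root_no_out e.1 hc e.2 he
    · exact h.existsUnique_out v fun hc => hc hv
  · rintro ⟨ha, h⟩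
    exact ⟨fun v w hvw => ha _ hvw, fun v hv => h.existsUnique_out v (not_not.1 hv),
      fun v hv w hvw => hv (h.fst_mem _ hvw), h.acyclic⟩

theorem mem_forests_iff [Zero K] {a : Matrix (Fin (n + r)) (Fin (n + r)) K}
    {F : Finset (Fin (n + r) × Fin (n + r))} :
    F ∈ forests a ↔ (∀ e ∈ F, a e.1 e.2 ≠ 0) ∧ EvenBranching (nonRoots n r) F := by
  simp only [forests, Finset.mem_filter, Finset.mem_univ, true_and]
  rw [isSpanningForest_iff, ← isForestOn_and_conditionC_iff, rootSet_eq_compl, and_assoc]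

theorem subDet_nonRoots [CommRing K] (a : Matrix (Fin (n + r)) (Fin (n + r)) K) :
    subDet a (nonRoots n r) = (principal a).det := by
  let e : Fin n ≃ nonRoots n r := Equiv.ofBijective
    (fun i => ⟨Fin.castAdd r i, castAdd_mem_nonRoots i⟩)
    ⟨fun i j h => Fin.castAdd_injective n r (congrArg Subtype.val h), fun v =>
      (exists_castAdd_eq v.2).imp fun i hi => Subtype.ext hi⟩
  rw [subDet, ← Matrix.det_submatrix_equiv_self e]
  rfl

theorem weightSum_nonRoots [Field K] (a : Matrix (Fin (n + r)) (Fin (n + r)) K) :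
    weightSum a (EvenBranching (nonRoots n r)) = ∑ F ∈ forests a, ∏ e ∈ F, a e.1 e.2 := by
  classical
  symm
  -- Forests using a pair `ij` with `a i j = 0` have weight zero.
  refine Finset.sum_subset (fun F hF => by simpa using (mem_forests_iff.1 hF).2) fun F hF hF' => ?_
  rw [Finset.mem_filter] at hF
  rw [mem_forests_iff, not_and_or] at hF'
  have := hF'.resolve_right (not_not.2 hF.2)
  push Not at this
  obtain ⟨e, he, h0⟩ := this
  exact Finset.prod_eq_zero he h0

theorem mk_castAdd_mem_matchingEdges [Zero K] {a : Matrix (Fin (n + r)) (Fin (n + r)) K}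
    {M : (graph (principal a)).Subgraph} {i j : Fin n} :
    s(Fin.castAdd r i, Fin.castAdd r j) ∈ matchingEdges M ↔ M.Adj i j := by
  rw [matchingEdges, ← Sym2.map_mk,
    (Sym2.map.injective (Fin.castAdd_injective n r)).mem_set_image,
    SimpleGraph.Subgraph.mem_edgeSet]

theorem exists_of_mk_mem_matchingEdges [Zero K] {a : Matrix (Fin (n + r)) (Fin (n + r)) K}
    {M : (graph (principal a)).Subgraph} {v w : Fin (n + r)} (h : s(v, w) ∈ matchingEdges M) :
    ∃ i j, Fin.castAdd r i = v ∧ Fin.castAdd r j = w ∧ M.Adj i j := by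
  obtain ⟨e, he, heq⟩ := h
  induction e with
  | _ i j =>
    rw [SimpleGraph.Subgraph.mem_edgeSet] at he
    rw [Sym2.map_mk, Sym2.eq_iff] at heq
    rcases heq with ⟨h1, h2⟩ | ⟨h1, h2⟩
    exacts [⟨i, j, h1, h2, he⟩, ⟨j, i, h2, h1, he.symm⟩]

/-- The matching to which a forest belongs can be read off from its branches. -/
theorem adj_iff_mem_pathMatching [Zero K] {a : Matrix (Fin (n + r)) (Fin (n + r)) K}
    {M : (graph (principal a)).Subgraph} (hM : M.IsPerfectMatching)
    {F : Finset (Fin (n + r) × Fin (n + r))} (hF : F ∈ forestsOf a M)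
    {ps : List (List (Fin (n + r)))} (hps : Branching (nonRoots n r) F ps) (i j : Fin n) :
    M.Adj i j ↔ (Fin.castAdd r i, Fin.castAdd r j) ∈ pathMatching ps ∨
      (Fin.castAdd r j, Fin.castAdd r i) ∈ pathMatching ps := by
  obtain ⟨hF, hcomp, ps', hrun, hps'⟩ := hF
  rw [rootSet_eq_compl] at hrun
  obtain rfl := hrun.unique (fun _ _ _ => hps.isForestOn.eq_of_mem) hps.trimRun
  have heven : ∀ p ∈ ps, Even (pathEdges p).length := fun p hp =>
    (hps' p (List.mem_reverse.2 hp)).1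
  have huniq : ∀ i j j', M.Adj i j → M.Adj i j' → j = j' := fun i j j' h h' =>
    (hM.1 (hM.2 i)).unique h h'
  have hsub : ∀ e ∈ pathMatching ps, s(e.1, e.2) ∈ matchingEdges M := by
    refine hps.pathMatching_subset (M := fun v w => s(v, w) ∈ matchingEdges M)
      (fun u v h => Sym2.eq_swap ▸ h) ?_ heven ?_ ?_
    · intro v u u' h h'
      obtain ⟨i, j, rfl, rfl, hij⟩ := exists_of_mk_mem_matchingEdges h
      obtain ⟨i', j', hi, rfl, hij'⟩ := exists_of_mk_mem_matchingEdges h'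
      obtain rfl := Fin.castAdd_injective n r hi
      rw [huniq _ _ _ hij hij']
    · intro p hp e he
      obtain ⟨e', he', h⟩ := (hps' p (List.mem_reverse.2 hp)).2
      obtain rfl := Option.some.inj (he.symm.trans he')
      exact h
    · intro v hv
      obtain ⟨i, rfl⟩ := exists_castAdd_eq hv
      obtain ⟨j, hj, -⟩ := hM.1 (hM.2 i)
      have hmem := mk_castAdd_mem_matchingEdges.2 hj
      obtain ⟨v, w, hvw, heq⟩ := hcomp _ hmem
      refine ⟨Fin.castAdd r j, hmem, ?_⟩
      rcases Sym2.eq_iff.1 heq with ⟨rfl, rfl⟩ | ⟨rfl, rfl⟩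
      exacts [Or.inl hvw, Or.inr hvw]
  have hsub' : ∀ i j, (Fin.castAdd r i, Fin.castAdd r j) ∈ pathMatching ps → M.Adj i j :=
    fun i j h => mk_castAdd_mem_matchingEdges.1 (hsub _ h)
  constructor
  · intro hij
    have hpair := hps.isPairing heven
    obtain ⟨⟨v, w⟩, he, h⟩ := hpair.exists_mem _ (castAdd_mem_nonRoots i)
    obtain ⟨i', rfl⟩ := exists_castAdd_eq (hpair.mem _ he).1
    obtain ⟨j', rfl⟩ := exists_castAdd_eq (hpair.mem _ he).2
    have hadj := hsub' i' j' he
    rcases h with h | h <;> obtain rfl := Fin.castAdd_injective n r h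
    · obtain rfl := huniq _ _ _ hij hadj
      exact Or.inl he
    · obtain rfl := huniq _ _ _ hij hadj.symm
      exact Or.inr he
  · rintro (h | h)
    exacts [hsub' i j h, (hsub' j i h).symm]

/-- A set `m` of edges that pairs the vertices which are not roots, as a spanning subgraph of the
graph of `A`. -/
def matchingSubgraph [Zero K] (a : Matrix (Fin (n + r)) (Fin (n + r)) K)
    (m : Set (Fin (n + r) × Fin (n + r))) (ha : ∀ e ∈ m, a e.1 e.2 ≠ 0)
    (hm : IsPairing (nonRoots n r) m) : (graph (principal a)).Subgraph where
  verts := Set.univ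
  Adj i j := (Fin.castAdd r i, Fin.castAdd r j) ∈ m ∨ (Fin.castAdd r j, Fin.castAdd r i) ∈ m
  adj_sub := by
    rintro i j (h | h)
    · exact ⟨fun hij => hm.ne _ h (congrArg (Fin.castAdd r) hij), Or.inl (ha _ h)⟩
    · exact ⟨fun hij => hm.ne _ h (congrArg (Fin.castAdd r) hij.symm), Or.inr (ha _ h)⟩
  edge_vert _ := Set.mem_univ _
  symm := ⟨fun _ _ h => h.symm⟩

theorem isPerfectMatching_matchingSubgraph [Zero K] (a : Matrix (Fin (n + r)) (Fin (n + r)) K)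
    (m : Set (Fin (n + r) × Fin (n + r))) (ha : ∀ e ∈ m, a e.1 e.2 ≠ 0)
    (hm : IsPairing (nonRoots n r) m) : (matchingSubgraph a m ha hm).IsPerfectMatching := by
  refine ⟨fun i _ => ?_, fun i => Set.mem_univ i⟩
  obtain ⟨⟨v, w⟩, he, h⟩ := hm.exists_mem _ (castAdd_mem_nonRoots i)
  obtain ⟨i', rfl⟩ := exists_castAdd_eq (hm.mem _ he).1
  obtain ⟨j', rfl⟩ := exists_castAdd_eq (hm.mem _ he).2
  rcases h with h | h <;> obtain rfl := Fin.castAdd_injective n r h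
  · refine ⟨j', Or.inl he, ?_⟩
    rintro k (hk | hk)
    · have := hm.eq_of_mem _ hk _ he _ (Or.inl rfl) (Or.inl rfl)
      exact Fin.castAdd_injective n r (congrArg Prod.snd this)
    · have := hm.eq_of_mem _ hk _ he _ (Or.inr rfl) (Or.inl rfl)
      exact absurd (congrArg Prod.snd this) (hm.ne _ he)
  · refine ⟨i', Or.inr he, ?_⟩
    rintro k (hk | hk)
    · have := hm.eq_of_mem _ hk _ he _ (Or.inl rfl) (Or.inr rfl)
      exact absurd (congrArg Prod.fst this).symm (hm.ne _ he)
    · have := hm.eq_of_mem _ hk _ he _ (Or.inr rfl) (Or.inr rfl)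
      exact Fin.castAdd_injective n r (congrArg Prod.fst this)

/-- The matching consists of the alternate edges of the branches. -/
theorem exists_mem_forestsOf [Zero K] {a : Matrix (Fin (n + r)) (Fin (n + r)) K}
    {F : Finset (Fin (n + r) × Fin (n + r))} (hF : F ∈ forests a) :
    ∃ M : (graph (principal a)).Subgraph, M.IsPerfectMatching ∧ F ∈ forestsOf a M := by
  obtain ⟨ha, ps, hps, heven⟩ := mem_forests_iff.1 hF
  have hm := hps.isPairing heven
  have hsub := hps.mem_of_mem_pathMatching
  refine ⟨matchingSubgraph a (pathMatching ps) (fun e he => ha e (hsub e he)) hm,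
    isPerfectMatching_matchingSubgraph _ _ _ _, isSpanningForest_iff.2 ⟨ha, hps.isForestOn⟩,
    ?_, ps.reverse, rootSet_eq_compl ▸ hps.trimRun, fun p hp => ?_⟩
  · intro e he
    induction e with
    | _ v w =>
      obtain ⟨i, j, rfl, rfl, h | h⟩ := exists_of_mk_mem_matchingEdges he
      exacts [⟨_, _, hsub _ h, rfl⟩, ⟨_, _, hsub _ h, Sym2.eq_swap⟩]
  · rw [List.mem_reverse] at hp
    refine ⟨heven p hp, ?_⟩
    obtain ⟨⟨v, w⟩, hhead, he⟩ := hps.head_mem_pathMatching hp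
    refine ⟨_, hhead, ?_⟩
    obtain ⟨i, rfl⟩ := exists_castAdd_eq (hm.mem _ he).1
    obtain ⟨j, rfl⟩ := exists_castAdd_eq (hm.mem _ he).2
    exact mk_castAdd_mem_matchingEdges.2 (Or.inl he)

end Main

end TrimmedForest





theorem mainTheorem3 {K : Type*} [Field K] [CharZero K] (n r : ℕ) (hn : Even n)
    (a : Matrix (Fin (n + r)) (Fin (n + r)) K)
    (hskew : a.transpose = -a)
    (hcol : ∀ j, ∑ i, a i j = 0) :
    ((TrimmedForest.principal a).det =
      ∑ F ∈ TrimmedForest.forests a, ∏ e ∈ F, a e.1 e.2) ∧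
    ((TrimmedForest.forests a : Set (Finset (Fin (n + r) × Fin (n + r)))) =
      ⋃ M ∈ {M : (TrimmedForest.graph (TrimmedForest.principal a)).Subgraph |
        M.IsPerfectMatching}, TrimmedForest.forestsOf a M) ∧
    {M : (TrimmedForest.graph (TrimmedForest.principal a)).Subgraph |
        M.IsPerfectMatching}.PairwiseDisjoint (TrimmedForest.forestsOf a) := by
  open TrimmedForest in
  refine ⟨?_, ?_, ?_⟩
  · have hrow : ∀ i, ∑ j, a i j = 0 := by
      intro i
      have h : ∀ j, a i j = -a j i := fun j => congrFun (congrFun hskew j) i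
      simp [h, hcol]
    rw [← subDet_nonRoots, ← weightSum_nonRoots,
      weightSum_evenBranching hskew hrow (by simpa [nonRoots] using hn)]
  · ext F
    simp only [Finset.mem_coe, Set.mem_iUnion, Set.mem_ofPred_eq, exists_prop]
    refine ⟨exists_mem_forestsOf, ?_⟩
    rintro ⟨M, -, hF, -, ps, hrun, hps⟩
    simp only [forests, Finset.mem_filter, Finset.mem_univ, true_and]
    exact ⟨hF, ps, hrun, fun p hp => (hps p hp).1⟩
  · intro M hM M' hM' hne
    refine Set.disjoint_left.2 fun F hF hF' => hne ?_
    obtain ⟨ps, hps⟩ := (isSpanningForest_iff.1 hF.1).2.exists_branching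
    refine SimpleGraph.Subgraph.ext ?_ ?_
    · rw [hM.2.verts_eq_univ, hM'.2.verts_eq_univ]
    · ext i j
      rw [adj_iff_mem_pathMatching hM hF hps, adj_iff_mem_pathMatching hM' hF' hps]
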